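/- Let $\Omega\subset\mathbb{R}^n$ be a bounded domain (a non-empty, open, connected and bounded set), and let $F:\Omega\to\mathbb{R}$ be continuous with $$\inf_{\Omega}F>0\qquad\text{or}\qquad \sup_{\Omega}F<0 .$$ For a $C^2$ function $\phi$ write $$\Delta_\infty\phi=\sum_{i,j=1}^n\frac{\partial\phi}{\partial x_i}\frac{\partial\phi}{\partial x_j}\frac{\partial^2\phi}{\partial x_i\,\partial x_j}.$$ Let $u,v\in C(\overline\Omega)$ be real-valued functions such that, in the viscosity sense, $$\Delta_\infty v\le F\qquad\text{and}\qquad\Delta_\infty u\ge F\qquad\text{in }\Omega .$$ That is: $\Delta_\infty\phi(x_0)\le F(x_0)$ whenever $x_0\in\Omega$ and $\phi\in C^2(\Omega)$ satisfy $\phi(x_0)=v(x_0)$ and $\phi(x)<v(x)$ for all $x\in\Omega\setminus\{x_0\}$; and $\Delta_\infty\psi(x_0)\ge F(x_0)$ whenever $x_0\in\Omega$ and $\psi\in C^2(\Omega)$ satisfy $\psi(x_0)=u(x_0)$ and $\psi(x)>u(x)$ for all $x\in\Omega\setminus\{x_0\}$. If $v\ge u$ on $\partial\Omega$, then $v\ge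 u$ in $\Omega$. -/

import Mathlib

/-- The `∞`-Laplace operator on functions of `n` real variables, evaluated at the point `x`:
`Δ_∞ φ (x) = ∑_{i,j} (∂φ/∂x_i) (∂φ/∂x_j) (∂²φ/∂x_i∂x_j)`. It is only applied to functions that
are of class `C²` in a neighbourhood of `x`. -/
noncomputable def infinityLaplacian {n : ℕ} (φ : EuclideanSpace ℝ (Fin n) → ℝ)
    (x : EuclideanSpace ℝ (Fin n)) : ℝ :=
  ∑ i : Fin n, ∑ j : Fin n,
    fderiv ℝ φ x (EuclideanSpace.single i 1) * fderiv ℝ φ x (EuclideanSpace.single j 1) *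
      fderiv ℝ (fderiv ℝ φ) x (EuclideanSpace.single i 1) (EuclideanSpace.single j 1)

/-- `φ` touches `v` (strictly) from below at the point `x₀`, relative to the set `Ω`. -/
def TouchesFromBelow {n : ℕ} (Ω : Set (EuclideanSpace ℝ (Fin n)))
    (φ v : EuclideanSpace ℝ (Fin n) → ℝ) (x₀ : EuclideanSpace ℝ (Fin n)) : Prop :=
  v x₀ = φ x₀ ∧ ∀ x ∈ Ω, x ≠ x₀ → φ x < v x

/-- `ψ` touches `u` (strictly) from above at the point `x₀`, relative to the set `Ω`. -/
def TouchesFromAbove {n : ℕ} (Ω : Set (EuclideanSpace ℝ (Fin n)))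
    (ψ u : EuclideanSpace ℝ (Fin n) → ℝ) (x₀ : EuclideanSpace ℝ (Fin n)) : Prop :=
  u x₀ = ψ x₀ ∧ ∀ x ∈ Ω, x ≠ x₀ → u x < ψ x

/-- `Δ_∞ v ≤ F` in `Ω` in the viscosity sense, for a real-valued function `v` on the open
set `Ω`. -/
def IsViscositySupersolution {n : ℕ} (Ω : Set (EuclideanSpace ℝ (Fin n)))
    (F v : EuclideanSpace ℝ (Fin n) → ℝ) : Prop :=
  LowerSemicontinuousOn v Ω ∧
    ∀ x₀ ∈ Ω, ∀ φ : EuclideanSpace ℝ (Fin n) → ℝ, ContDiffOn ℝ 2 φ Ω →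
      TouchesFromBelow Ω φ v x₀ → infinityLaplacian φ x₀ ≤ F x₀

/-- `Δ_∞ u ≥ F` in `Ω` in the viscosity sense, for a real-valued function `u` on the open
set `Ω`. -/
def IsViscositySubsolution {n : ℕ} (Ω : Set (EuclideanSpace ℝ (Fin n)))
    (F u : EuclideanSpace ℝ (Fin n) → ℝ) : Prop :=
  UpperSemicontinuousOn u Ω ∧
    ∀ x₀ ∈ Ω, ∀ ψ : EuclideanSpace ℝ (Fin n) → ℝ, ContDiffOn ℝ 2 ψ Ω →
      TouchesFromAbove Ω ψ u x₀ → F x₀ ≤ infinityLaplacian ψ x₀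

/-!
Write `w` for `-v`, `G` for its right-hand side, and `M_u(x, r)` for the maximum of `u` over
`closedBall x r`. Suppose first that `0 < F` and `0 < F + G`. As a function of `r`, `M_u(x, r)` is
an increasing one-dimensional viscosity subsolution of `f'' (f')² ≥ c`, and `M_w(x, r)` is a
subsolution of the same kind with a constant `d > -c`. Comparison with a parabola and its
reflection then produces `|t| ≤ ε` with `M_u(x, ε) + M_w(x, ε) < M_u(x, ε + t) + M_w(x, ε - t)`.
Maximum points of `u` and `w` on the two balls on the right are at distance at most `2ε` from each
other, so both lie in the closed `ε`-ball about their midpoint `z`, and `M_u(z, ε) + M_w(z, ε)`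
exceeds its value at `x`. Hence `M_u(·, ε) + M_w(·, ε)` has no maximum well inside `Ω`, and as
`ε → 0` neither can `u + w` have a positive one. The case `G = -F` is reached by scaling `u` by
`1 + δ`, which turns `F` into `(1 + δ)³ F`.
-/

open Filter Topology Metric Set
open scoped Gradient

section GradientDirection

theorem deriv_deriv_comp_line {E : Type*} [NormedAddCommGroup E] [NormedSpace ℝ E] {φ : E → ℝ}
    {x : E} (hφ : ContDiffAt ℝ 2 φ x) (p : E) :
    deriv (deriv fun t : ℝ => φ (x + t • p)) 0 = fderiv ℝ (fderiv ℝ φ) x p p := by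
  have hline (t : ℝ) : HasDerivAt (fun t : ℝ => x + t • p) p t := by
    simpa using ((hasDerivAt_id t).smul_const p).const_add x
  have hfderiv : HasFDerivAt (fderiv ℝ φ) (fderiv ℝ (fderiv ℝ φ) x) x :=
    ((hφ.fderiv_right (m := 1) (by norm_num)).differentiableAt one_ne_zero).hasFDerivAt
  have hsmooth : ∀ᶠ t in 𝓝 (0 : ℝ), ContDiffAt ℝ 2 φ (x + t • p) :=
    (hline 0).continuousAt.eventually (by simpa using hφ.eventually (by simp))
  have hderiv : deriv (fun t : ℝ => φ (x + t • p)) =ᶠ[𝓝 0] fun t => fderiv ℝ φ (x + t • p) p := by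
    filter_upwards [hsmooth] with t ht
    exact ((ht.differentiableAt two_ne_zero).hasFDerivAt.comp_hasDerivAt t (hline t)).deriv
  have hfderiv_line : HasDerivAt (fun t : ℝ => fderiv ℝ φ (x + t • p))
      (fderiv ℝ (fderiv ℝ φ) x p) 0 :=
    hfderiv.comp_hasDerivAt_of_eq 0 (hline 0) (by simp)
  rw [hderiv.deriv_eq]
  exact (((ContinuousLinearMap.apply ℝ ℝ p).hasFDerivAt (x := fderiv ℝ φ (x + (0 : ℝ) • p))
    ).comp_hasDerivAt 0 hfderiv_line).deriv

variable {n : ℕ} {φ : EuclideanSpace ℝ (Fin n) → ℝ} {x p : EuclideanSpace ℝ (Fin n)}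

theorem infinityLaplacian_eq_fderiv_fderiv (hp : HasGradientAt φ p x) :
    infinityLaplacian φ x = fderiv ℝ (fderiv ℝ φ) x p p := by
  have hsum : p = ∑ i, p i • EuclideanSpace.single i (1 : ℝ) := by
    ext j
    simp [Pi.single_apply]
  conv_rhs => rw [hsum]
  simp only [infinityLaplacian, hp.fderiv_apply, EuclideanSpace.inner_single_right, map_sum,
    map_smul, sum_apply, smul_apply, smul_eq_mul, Finset.mul_sum]
  rw [Finset.sum_comm]
  refine Finset.sum_congr rfl fun i _ => Finset.sum_congr rfl fun j _ => ?_
  simp only [one_mul, conj_trivial]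
  ring

theorem infinityLaplacian_eq_deriv_deriv (hφ : ContDiffAt ℝ 2 φ x) (hp : HasGradientAt φ p x) :
    infinityLaplacian φ x = deriv (deriv fun t : ℝ => φ (x + t • p)) 0 := by
  rw [infinityLaplacian_eq_fderiv_fderiv hp, deriv_deriv_comp_line hφ]

theorem infinityLaplacian_congr {ψ : EuclideanSpace ℝ (Fin n) → ℝ} (h : φ =ᶠ[𝓝 x] ψ) :
    infinityLaplacian φ x = infinityLaplacian ψ x := by
  simp only [infinityLaplacian, h.fderiv_eq, h.fderiv.fderiv_eq]

theorem infinityLaplacian_const_mul (c : ℝ) (φ : EuclideanSpace ℝ (Fin n) → ℝ)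
    (x : EuclideanSpace ℝ (Fin n)) :
    infinityLaplacian (fun y => c * φ y) x = c ^ 3 * infinityLaplacian φ x := by
  have hfderiv : fderiv ℝ (fun y => c * φ y) = c • fderiv ℝ φ :=
    fderiv_const_smul_field (f := φ) c
  have hhessian : fderiv ℝ (c • fderiv ℝ φ) = c • fderiv ℝ (fderiv ℝ φ) :=
    fderiv_const_smul_field (f := fderiv ℝ φ) c
  simp only [infinityLaplacian, hfderiv, hhessian, Pi.smul_apply, smul_apply, smul_eq_mul,
    Finset.mul_sum]
  exact Finset.sum_congr rfl fun i _ => Finset.sum_congr rfl fun j _ => by ring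

theorem infinityLaplacian_const (c : ℝ) (x : EuclideanSpace ℝ (Fin n)) :
    infinityLaplacian (fun _ => c) x = 0 := by
  simp [infinityLaplacian]

theorem infinityLaplacian_add_const (φ : EuclideanSpace ℝ (Fin n) → ℝ) (c : ℝ)
    (x : EuclideanSpace ℝ (Fin n)) :
    infinityLaplacian (fun y => φ y + c) x = infinityLaplacian φ x := by
  have hfderiv : fderiv ℝ (fun y => φ y + c) = fderiv ℝ φ := funext fun y => fderiv_add_const c
  simp only [infinityLaplacian, hfderiv]

theorem contDiff_norm_sub_pow_four {E : Type*} [NormedAddCommGroup E] [InnerProductSpace ℝ E]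
    {k : WithTop ℕ∞} (x : E) : ContDiff ℝ k fun y => ‖y - x‖ ^ 4 := by
  have hsq : ContDiff ℝ k fun y => (‖y - x‖ ^ 2) ^ 2 :=
    ((contDiff_id.sub contDiff_const).norm_sq ℝ).pow 2
  simpa only [← pow_mul] using hsq

theorem infinityLaplacian_add_norm_sub_pow_four (hφ : ContDiffAt ℝ 2 φ x) :
    infinityLaplacian (fun y => φ y + ‖y - x‖ ^ 4) x = infinityLaplacian φ x := by
  set g : EuclideanSpace ℝ (Fin n) → ℝ := fun y => ‖y - x‖ ^ 4 with hg_def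
  have hg : ContDiff ℝ 2 g := contDiff_norm_sub_pow_four x
  have hg_fderiv : fderiv ℝ g x = 0 :=
    IsLocalMin.fderiv_eq_zero (Eventually.of_forall fun y => by simp [hg_def])
  have hg_hessian (p : EuclideanSpace ℝ (Fin n)) : fderiv ℝ (fderiv ℝ g) x p p = 0 := by
    have hline : (fun t : ℝ => g (x + t • p)) = fun t => ‖p‖ ^ 4 * t ^ 4 := by
      ext t
      simp only [hg_def, add_sub_cancel_left, norm_smul, mul_pow, Real.norm_eq_abs,
        (show Even 4 by decide).pow_abs]
      ring
    rw [← deriv_deriv_comp_line hg.contDiffAt, hline]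
    simp
  have hφ_grad := (hφ.differentiableAt two_ne_zero).hasGradientAt
  have hsum_grad : HasGradientAt (fun y => φ y + g y) (∇ φ x) x := by
    exact hasGradientAt_iff_hasFDerivAt.2 ((hφ_grad.hasFDerivAt.add
      (hg.differentiable two_ne_zero x).hasFDerivAt).congr_fderiv (by simp [hg_fderiv]))
  have hfderiv : fderiv ℝ (fun y => φ y + g y) =ᶠ[𝓝 x] fderiv ℝ φ + fderiv ℝ g := by
    filter_upwards [hφ.eventually (by simp)] with y hy
    exact fderiv_add (hy.differentiableAt two_ne_zero) (hg.differentiable two_ne_zero y)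
  have hdiff {f : EuclideanSpace ℝ (Fin n) → ℝ} (hf : ContDiffAt ℝ 2 f x) :
      DifferentiableAt ℝ (fderiv ℝ f) x :=
    (hf.fderiv_right (m := 1) (by norm_num)).differentiableAt one_ne_zero
  rw [infinityLaplacian_eq_fderiv_fderiv hsum_grad, infinityLaplacian_eq_fderiv_fderiv hφ_grad,
    hfderiv.fderiv_eq, fderiv_add (hdiff hφ) (hdiff hg.contDiffAt)]
  simp [hg_hessian]

end GradientDirection

theorem hasGradientAt_norm {E : Type*} [NormedAddCommGroup E] [InnerProductSpace ℝ E]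
    [CompleteSpace E] {x : E} (hx : x ≠ 0) : HasGradientAt (fun y : E => ‖y‖) (‖x‖⁻¹ • x) x := by
  have hsqrt := ((hasFDerivAt_id x).norm_sq).sqrt (by simpa using hx)
  simp only [id_eq, Real.sqrt_sq (norm_nonneg _)] at hsqrt
  refine hasGradientAt_iff_hasFDerivAt.2 (hsqrt.congr_fderiv ?_)
  ext a
  simp
  field_simp

theorem contDiffAt_comp_norm_sub {E : Type*} [NormedAddCommGroup E] [InnerProductSpace ℝ E]
    {k : WithTop ℕ∞} {x₀ z : E} (hz : z ≠ x₀) {q : ℝ → ℝ} (hq : ContDiffAt ℝ k q ‖z - x₀‖) :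
    ContDiffAt ℝ k (fun x => q ‖x - x₀‖) z :=
  hq.comp z ((contDiffAt_id.sub contDiffAt_const).norm ℝ (sub_ne_zero.2 hz))

theorem infinityLaplacian_comp_norm_sub {n : ℕ} {x₀ z : EuclideanSpace ℝ (Fin n)} (hz : z ≠ x₀)
    {q : ℝ → ℝ} (hq : ContDiffAt ℝ 2 q ‖z - x₀‖) :
    infinityLaplacian (fun x => q ‖x - x₀‖) z =
      deriv q ‖z - x₀‖ ^ 2 * deriv (deriv q) ‖z - x₀‖ := by
  have hne : z - x₀ ≠ 0 := sub_ne_zero.2 hz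
  have hr : 0 < ‖z - x₀‖ := norm_pos_iff.2 hne
  set r := ‖z - x₀‖ with hr_def
  have hgrad : HasGradientAt (fun x => q ‖x - x₀‖) ((deriv q r / r) • (z - x₀)) z := by
    have hnorm := (hasGradientAt_norm hne).hasFDerivAt.comp z ((hasFDerivAt_id z).sub_const x₀)
    refine hasGradientAt_iff_hasFDerivAt.2
      (((hq.differentiableAt two_ne_zero).hasDerivAt.comp_hasFDerivAt z hnorm).congr_fderiv ?_)
    ext a
    simp [← hr_def]
    ring
  have hline : (fun t : ℝ => q ‖z + t • (deriv q r / r) • (z - x₀) - x₀‖) =ᶠ[𝓝 0]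
      fun t => q (r + deriv q r * t) := by
    have hpos : ∀ᶠ t in 𝓝 (0 : ℝ), 0 < 1 + t * (deriv q r / r) :=
      ContinuousAt.eventually_lt (by fun_prop) (by fun_prop) (by simp)
    filter_upwards [hpos] with t ht
    have hfactor : z + t • (deriv q r / r) • (z - x₀) - x₀ =
        (1 + t * (deriv q r / r)) • (z - x₀) := by module
    rw [hfactor, norm_smul, Real.norm_of_nonneg ht.le, ← hr_def]
    congr 1
    field_simp
  rw [infinityLaplacian_eq_deriv_deriv (contDiffAt_comp_norm_sub hz hq) hgrad, hline.deriv.deriv_eq]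
  have hderiv (f : ℝ → ℝ) : deriv (fun t => f (r + deriv q r * t)) =
      fun t => deriv q r * deriv f (r + deriv q r * t) := by
    funext t
    rw [deriv_comp_mul_left (deriv q r) (fun s => f (r + s)), deriv_comp_const_add, smul_eq_mul]
  simp only [hderiv, deriv_const_mul_field, mul_zero, add_zero]
  ring

section LocalSubsolutions

variable {n : ℕ} {Ω Ω' : Set (EuclideanSpace ℝ (Fin n))} {F u v : EuclideanSpace ℝ (Fin n) → ℝ}

/-- `Δ_∞ u ≥ F` in the open set `Ω` in the viscosity sense, tested with functions that are `C²` near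
the point of contact and touch `u` from above only locally and not necessarily strictly. Touching
is normalised as a local maximum of `u - ψ`. A supersolution `v` is handled through `-v`. -/
def IsLocalSubsolution (Ω : Set (EuclideanSpace ℝ (Fin n)))
    (F u : EuclideanSpace ℝ (Fin n) → ℝ) : Prop :=
  ∀ z ∈ Ω, ∀ ψ : EuclideanSpace ℝ (Fin n) → ℝ, ContDiffAt ℝ 2 ψ z →
    IsLocalMax (fun y => u y - ψ y) z → F z ≤ infinityLaplacian ψ z

namespace IsLocalSubsolution

theorem mono (hu : IsLocalSubsolution Ω' F u) (hΩ : Ω ⊆ Ω') : IsLocalSubsolution Ω F u :=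
  fun z hz => hu z (hΩ hz)

theorem congr (hu : IsLocalSubsolution Ω F u) (hΩ : IsOpen Ω) (huv : EqOn u v Ω) :
    IsLocalSubsolution Ω F v := by
  intro z hz ψ hψ hmax
  have hsub : (fun y => v y - ψ y) =ᶠ[𝓝 z] fun y => u y - ψ y :=
    (huv.eventuallyEq_of_mem (hΩ.mem_nhds hz)).symm.sub .rfl
  exact hu z hz ψ hψ (hsub.isLocalMax_iff.1 hmax)

theorem const_mul_add (hu : IsLocalSubsolution Ω F u) {l : ℝ} (hl : 0 < l) (b : ℝ) :
    IsLocalSubsolution Ω (fun x => l ^ 3 * F x) (fun x => l * u x + b) := by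
  intro z hz ψ hψ hmax
  have htest : IsLocalMax (fun y => u y - l⁻¹ * ψ y) z := by
    refine hmax.mono fun y hy => le_of_mul_le_mul_left ?_ hl
    simp only [mul_sub, mul_inv_cancel_left₀ hl.ne']
    linarith
  have := hu z hz _ (contDiffAt_const.mul hψ) htest
  rw [infinityLaplacian_const_mul, inv_pow] at this
  exact (le_inv_mul_iff₀ (pow_pos hl 3)).1 this

end IsLocalSubsolution

theorem exists_contDiff_eventuallyEq_lt {E : Type*} [NormedAddCommGroup E] [NormedSpace ℝ E]
    [HasContDiffBump E] {k : ℕ} {Ω : Set E} {u ψ : E → ℝ} {z : E} {N : ℝ}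
    (hψ : ContDiffAt ℝ k ψ z) (hlt : ∀ᶠ y in 𝓝[≠] z, u y < ψ y) (hN : ∀ y ∈ Ω, u y < N) :
    ∃ φ : E → ℝ, ContDiff ℝ k φ ∧ φ =ᶠ[𝓝 z] ψ ∧ ∀ y ∈ Ω, y ≠ z → u y < φ y := by
  obtain ⟨δ, hδ, hball⟩ := Metric.eventually_nhds_iff_ball.1
    ((hψ.eventually (by simp)).and (eventually_nhdsWithin_iff.1 hlt))
  let f : ContDiffBump z := ⟨δ / 3, δ / 2, by positivity, by linarith⟩
  refine ⟨fun y => N + f y * (ψ y - N), contDiff_iff_contDiffAt.2 fun x => ?_, ?_, ?_⟩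
  · by_cases hx : x ∈ tsupport f
    · have hxδ : x ∈ ball z δ :=
        closedBall_subset_ball (by simp only [f]; linarith) (f.tsupport_eq ▸ hx)
      exact contDiffAt_const.add (f.contDiffAt.mul ((hball x hxδ).1.sub contDiffAt_const))
    · refine contDiffAt_const (c := N) |>.congr_of_eventuallyEq ?_
      filter_upwards [notMem_tsupport_iff_eventuallyEq.1 hx] with y hy
      simp [hy]
  · filter_upwards [f.eventuallyEq_one] with y hy
    simp [hy]
  · intro y hy hyz
    rcases le_or_gt δ (dist y z) with hfar | hnear
    · have : f y = 0 := f.zero_of_le_dist (by simp only [f]; linarith)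
      simpa [this] using hN y hy
    · have huψ : u y < ψ y := (hball y hnear).2 hyz
      rcases f.nonneg.eq_or_lt' (a := f y) with hzero | hpos
      · simpa [hzero] using hN y hy
      · calc u y = (1 - f y) * u y + f y * u y := by ring
          _ < (1 - f y) * N + f y * ψ y :=
            add_lt_add_of_le_of_lt
              (mul_le_mul_of_nonneg_left (hN y hy).le (sub_nonneg.2 f.le_one))
              (mul_lt_mul_of_pos_left huψ hpos)
          _ = N + f y * (ψ y - N) := by ring

theorem IsViscositySubsolution.isLocalSubsolution (hu : IsViscositySubsolution Ω F u)
    (hbdd : BddAbove (u '' Ω)) : IsLocalSubsolution Ω F u := by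
  intro z hz ψ hψ hmax
  obtain ⟨B, hB⟩ := hbdd
  -- The quartic makes the contact strict without changing the second-order jet at `z`.
  set χ := fun y => ψ y + (u z - ψ z) + ‖y - z‖ ^ 4
  have hshift : ContDiffAt ℝ 2 (fun y => ψ y + (u z - ψ z)) z := hψ.add contDiffAt_const
  have hχ : ContDiffAt ℝ 2 χ z := hshift.add (contDiff_norm_sub_pow_four z).contDiffAt
  have hlt : ∀ᶠ y in 𝓝[≠] z, u y < χ y := by
    filter_upwards [nhdsWithin_le_nhds hmax, self_mem_nhdsWithin] with y hy hyz
    have : 0 < ‖y - z‖ ^ 4 := pow_pos (norm_pos_iff.2 (sub_ne_zero.2 hyz)) 4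
    linarith
  obtain ⟨φ, hφ, hφχ, hφ_lt⟩ := exists_contDiff_eventuallyEq_lt hχ hlt
    fun y hy => (hB (mem_image_of_mem u hy)).trans_lt (lt_add_one B)
  have hφz : u z = φ z := by simp [hφχ.self_of_nhds, χ]
  calc F z ≤ infinityLaplacian φ z := hu.2 z hz φ hφ.contDiffOn ⟨hφz, hφ_lt⟩
    _ = infinityLaplacian χ z := infinityLaplacian_congr hφχ
    _ = infinityLaplacian ψ z := by
      rw [infinityLaplacian_add_norm_sub_pow_four hshift, infinityLaplacian_add_const]

theorem IsViscositySupersolution.neg (hv : IsViscositySupersolution Ω F v) :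
    IsViscositySubsolution Ω (fun x => -F x) (fun x => -v x) := by
  refine ⟨hv.1.neg, fun x hx ψ hψ htouch => ?_⟩
  have := hv.2 x hx (fun y => -1 * ψ y) (contDiffOn_const.mul hψ)
    ⟨by linarith [htouch.1], fun y hy hyx => by linarith [htouch.2 y hy hyx]⟩
  rw [infinityLaplacian_const_mul] at this
  linarith

end LocalSubsolutions

section OneDimensional

/-- `f'' (f')² ≥ c` on `I` in the viscosity sense, tested only with functions increasing through the
point of contact. Touching is normalised as a local maximum of `f - q`. This is the equation
inherited by the radial maximum functions of a subsolution of `Δ_∞ u = F`. -/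
def IsIncreasingSubsolutionOn (c : ℝ) (f : ℝ → ℝ) (I : Set ℝ) : Prop :=
  ∀ t ∈ I, ∀ q : ℝ → ℝ, ContDiffAt ℝ 2 q t → 0 < deriv q t →
    IsLocalMax (fun s => f s - q s) t → c ≤ deriv q t ^ 2 * deriv (deriv q) t

theorem exists_isLocalMax_mem_Ioo {f : ℝ → ℝ} {a b c : ℝ} (hf : ContinuousOn f (Icc a b))
    (hc : c ∈ Ioo a b) (ha : f a ≤ f c) (hb : f b ≤ f c) : ∃ t ∈ Ioo a b, IsLocalMax f t := by
  obtain ⟨t, ht, hmax⟩ := isCompact_Icc.exists_isMaxOn ⟨c, Ioo_subset_Icc_self hc⟩ hf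
  by_cases ht' : t ∈ Ioo a b
  · exact ⟨t, ht', hmax.isLocalMax (Icc_mem_nhds ht'.1 ht'.2)⟩
  · have htc : f t ≤ f c := by
      rcases eq_endpoints_or_mem_Ioo_of_mem_Icc ht with rfl | rfl | h
      exacts [ha, hb, absurd h ht']
    exact ⟨c, hc, IsMaxOn.isLocalMax (fun y hy => (hmax hy).trans htc) (Icc_mem_nhds hc.1 hc.2)⟩

theorem exists_quadratic_bounds {k lo hi s : ℝ} (hs : 0 < s) (hk : 0 < k) (hlo : lo < k)
    (hhi : k < hi) : ∃ δ > 0, ∀ m ≥ s, ∀ h, |h| < δ →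
      0 < m + k / m ^ 2 * h ∧ lo < (m + k / m ^ 2 * h) ^ 2 * (k / m ^ 2) ∧
        (m + k / m ^ 2 * h) ^ 2 * (k / m ^ 2) < hi := by
  have hnear : ∀ᶠ y in 𝓝 (0 : ℝ), 0 < 1 + y ∧ lo < (1 + y) ^ 2 * k ∧ (1 + y) ^ 2 * k < hi :=
    (ContinuousAt.eventually_lt (by fun_prop) (by fun_prop) (by simp)).and
      ((ContinuousAt.eventually_lt (by fun_prop) (by fun_prop) (by simpa)).and
        (ContinuousAt.eventually_lt (by fun_prop) (by fun_prop) (by simpa)))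
  obtain ⟨η, hη, hball⟩ := Metric.eventually_nhds_iff.1 hnear
  refine ⟨η * s ^ 3 / k, by positivity, fun m hm h hh => ?_⟩
  have hm0 : 0 < m := hs.trans_le hm
  have hy : |k * h / m ^ 3| < η := by
    rw [abs_div, abs_mul, abs_of_pos hk, abs_of_pos (pow_pos hm0 3), div_lt_iff₀ (by positivity)]
    calc k * |h| < η * s ^ 3 := by rwa [lt_div_iff₀' hk] at hh
      _ ≤ η * m ^ 3 := by gcongr
  obtain ⟨h₁, h₂, h₃⟩ := hball (by simpa using hy)
  have hfactor : m + k / m ^ 2 * h = m * (1 + k * h / m ^ 3) := by field_simp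
  have hsq : (m + k / m ^ 2 * h) ^ 2 * (k / m ^ 2) = (1 + k * h / m ^ 3) ^ 2 * k := by
    rw [hfactor]
    field_simp
  rw [hsq, hfactor]
  exact ⟨mul_pos hm0 h₁, h₂, h₃⟩

namespace IsIncreasingSubsolutionOn

variable {f w : ℝ → ℝ} {c d a r x y z : ℝ}

theorem sub_quadratic_lt_max (hf : IsIncreasingSubsolutionOn c f (Ioo x y))
    (hcont : ContinuousOn f (Icc x y)) (m g : ℝ) (hpos : ∀ t ∈ Ioo x y, 0 < m + g * (t - a))
    (hlt : ∀ t ∈ Ioo x y, (m + g * (t - a)) ^ 2 * g < c) (hz : z ∈ Ioo x y) :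
    f z - (m * (z - a) + g / 2 * (z - a) ^ 2) <
      max (f x - (m * (x - a) + g / 2 * (x - a) ^ 2))
        (f y - (m * (y - a) + g / 2 * (y - a) ^ 2)) := by
  by_contra! hle
  set q : ℝ → ℝ := fun s => m * (s - a) + g / 2 * (s - a) ^ 2
  have hq : ContDiff ℝ 2 q := by fun_prop
  have hderiv : deriv q = fun t => m + g * (t - a) := by
    ext t
    have hsub : HasDerivAt (fun s => s - a) 1 t := (hasDerivAt_id t).sub_const a
    refine ((hsub.const_mul m).add ((hsub.pow 2).const_mul (g / 2))).deriv.trans ?_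
    norm_num
    ring
  obtain ⟨t, ht, hmax⟩ := exists_isLocalMax_mem_Ioo (hcont.sub hq.continuous.continuousOn) hz
    ((le_max_left _ _).trans hle) ((le_max_right _ _).trans hle)
  refine (hlt t ht).not_ge ?_
  simpa [hderiv] using hf t ht q hq.contDiffAt (by simpa [hderiv] using hpos t ht) hmax

theorem mono {I J : Set ℝ} (hf : IsIncreasingSubsolutionOn c f J) (hIJ : I ⊆ J) :
    IsIncreasingSubsolutionOn c f I :=
  fun t ht => hf t (hIJ ht)

theorem slope_lt_slope (hf : IsIncreasingSubsolutionOn c f (Ioo x z))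
    (hcont : ContinuousOn f (Icc x z)) (hc : 0 < c) (hxy : x < y) (hyz : y < z) (hlt : f x < f y) :
    slope f x y < slope f y z := by
  have hm : 0 < slope f x y := (slope_pos_iff_of_le hxy.le).2 hlt
  have haffine := hf.sub_quadratic_lt_max (a := y) hcont (slope f x y) 0
    (by simpa using fun _ _ _ => hm) (by simpa using fun _ _ _ => hc) ⟨hxy, hyz⟩
  have hx : f x - slope f x y * (x - y) = f y := by
    have := sub_smul_slope f x y
    rw [smul_eq_mul, vsub_eq_sub] at this
    linarith
  simp only [sub_self, mul_zero, zero_div, zero_mul, add_zero, sub_zero, ne_eq, OfNat.ofNat_ne_zero,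
    not_false_eq_true, zero_pow, hx, lt_sup_iff, lt_self_iff_false, false_or] at haffine
  rw [slope_def_field f y z, lt_div_iff₀ (sub_pos.2 hyz)]
  linarith

theorem lt_add_or_lt_add_of_chord {m γ τ : ℝ}
    (hf : IsIncreasingSubsolutionOn c f (Ioo (a - τ) (a + τ)))
    (hw : IsIncreasingSubsolutionOn d w (Ioo (a - τ) (a + τ)))
    (hf_cont : ContinuousOn f (Icc (a - τ) (a + τ)))
    (hw_cont : ContinuousOn w (Icc (a - τ) (a + τ))) (hτ : 0 < τ)
    (hbounds : ∀ h, |h| < 2 * τ →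
      0 < m + γ * h ∧ -d < (m + γ * h) ^ 2 * γ ∧ (m + γ * h) ^ 2 * γ < c)
    (hchord : f (a + τ) = f a + m * τ) :
    f a + w a < f (a + τ) + w (a - τ) ∨ f a + w a < f (a - τ) + w (a + τ) := by
  have ha : a ∈ Ioo (a - τ) (a + τ) := ⟨by linarith, by linarith⟩
  -- Compare `f` with the parabola with second derivative `γ` through its values at `a` and `a + τ`,
  -- and `w` with minus the reflection of that parabola in `a`.
  have hf_left : f a - m * τ + γ * τ ^ 2 < f (a - τ) := by
    have hslope (t : ℝ) (ht : t ∈ Ioo (a - τ) (a + τ)) := hbounds (t - a - τ / 2)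
      (abs_lt.2 ⟨by linarith [ht.1], by linarith [ht.2]⟩)
    have hlin (t : ℝ) : m - γ * τ / 2 + γ * (t - a) = m + γ * (t - a - τ / 2) := by ring
    have := hf.sub_quadratic_lt_max hf_cont (m - γ * τ / 2) γ
      (fun t ht => hlin t ▸ (hslope t ht).1) (fun t ht => hlin t ▸ (hslope t ht).2.2) ha
    rw [lt_max_iff] at this
    rcases this with h | h <;> linarith
  have hw_max : w a < max (w (a - τ) + m * τ) (w (a + τ) - m * τ + γ * τ ^ 2) := by
    have hslope (t : ℝ) (ht : t ∈ Ioo (a - τ) (a + τ)) := hbounds (-(t - a + τ / 2))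
      (abs_lt.2 ⟨by linarith [ht.2], by linarith [ht.1]⟩)
    have hlin (t : ℝ) : m - γ * τ / 2 + -γ * (t - a) = m + γ * -(t - a + τ / 2) := by ring
    have := hw.sub_quadratic_lt_max hw_cont (m - γ * τ / 2) (-γ)
      (fun t ht => hlin t ▸ (hslope t ht).1)
      (fun t ht => hlin t ▸ by linarith [(hslope t ht).2.1]) ha
    convert this using 2 <;> ring
  exact (lt_max_iff.1 hw_max).imp (fun h => by linarith) (fun h => by linarith)

theorem exists_lt_add_reflect (hf : IsIncreasingSubsolutionOn c f (Ioo (a - r) (a + r)))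
    (hw : IsIncreasingSubsolutionOn d w (Ioo (a - r) (a + r)))
    (hf_cont : ContinuousOn f (Icc (a - r) (a + r)))
    (hw_cont : ContinuousOn w (Icc (a - r) (a + r)))
    (hc : 0 < c) (hcd : 0 < c + d) (hr : 0 < r) (hlt : f (a - r) < f a) :
    ∃ t ∈ Icc (-r) r, f a + w a < f (a + t) + w (a - t) := by
  obtain ⟨k, hk_max, hkc⟩ : ∃ k, max 0 (-d) < k ∧ k < c :=
    exists_between (max_lt hc (by linarith))
  obtain ⟨hk, hdk⟩ := max_lt_iff.1 hk_max
  obtain ⟨δ, hδ, hbounds⟩ := exists_quadratic_bounds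
    ((slope_pos_iff_of_le (by linarith)).2 hlt : 0 < slope f (a - r) a) hk hdk hkc
  obtain ⟨τ, hτ, hτ_lt⟩ : ∃ τ, 0 < τ ∧ τ < min r (δ / 2) := exists_between (by positivity)
  obtain ⟨hτr, hτδ⟩ := lt_min_iff.1 hτ_lt
  have hIcc : Icc (a - τ) (a + τ) ⊆ Icc (a - r) (a + r) :=
    Icc_subset_Icc (by linarith) (by linarith)
  have hIoo : Ioo (a - τ) (a + τ) ⊆ Ioo (a - r) (a + r) :=
    Ioo_subset_Ioo (by linarith) (by linarith)
  have hslope : slope f (a - r) a < slope f a (a + τ) :=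
    (hf.mono (Ioo_subset_Ioo_right (by linarith))).slope_lt_slope
      (hf_cont.mono (Icc_subset_Icc_right (by linarith))) hc (by linarith) (by linarith) hlt
  have hchord : f (a + τ) = f a + slope f a (a + τ) * τ := by
    have := sub_smul_slope f a (a + τ)
    rw [add_sub_cancel_left, smul_eq_mul, vsub_eq_sub] at this
    linarith
  rcases lt_add_or_lt_add_of_chord (hf.mono hIoo) (hw.mono hIoo) (hf_cont.mono hIcc)
    (hw_cont.mono hIcc) hτ (fun h hh => hbounds _ hslope.le h (by linarith)) hchord with h | h
  · exact ⟨τ, ⟨by linarith, hτr.le⟩, h⟩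
  · exact ⟨-τ, ⟨by linarith, by linarith⟩, by rwa [sub_neg_eq_add, ← sub_eq_add_neg]⟩

end IsIncreasingSubsolutionOn

end OneDimensional

section BallMax

variable {E : Type*} [NormedAddCommGroup E] [NormedSpace ℝ E] {u w : E → ℝ} {x₀ z : E} {r s ε : ℝ}

/-- The maximum of `u` over `closedBall x₀ r`, which is how it should be read for continuous `u` on
a finite-dimensional space and `0 ≤ r`. The ball is parametrised by the unit ball so that joint
continuity in `x₀` and `r` is immediate. -/
noncomputable def ballMax (u : E → ℝ) (x₀ : E) (r : ℝ) : ℝ :=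
  sSup ((fun y => u (x₀ + r • y)) '' closedBall 0 1)

theorem ballMax_eq_sSup_image (hr : 0 ≤ r) : ballMax u x₀ r = sSup (u '' closedBall x₀ r) := by
  rw [ballMax, ← affinity_unitClosedBall hr x₀, ← image_vadd, ← image_smul, image_image,
    image_image]
  rfl

@[simp]
theorem ballMax_zero : ballMax u x₀ 0 = u x₀ := by
  simp [ballMax_eq_sSup_image le_rfl]

variable [ProperSpace E]

theorem continuous_ballMax {X : Type*} [TopologicalSpace X] {x : X → E} {ρ : X → ℝ}
    (hu : Continuous u) (hx : Continuous x) (hρ : Continuous ρ) :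
    Continuous fun t => ballMax u (x t) (ρ t) :=
  (isCompact_closedBall (0 : E) 1).continuous_sSup (f := fun t y => u (x t + ρ t • y))
    (by fun_prop)

theorem exists_mem_closedBall_eq_ballMax (hu : Continuous u) (hr : 0 ≤ r) (x₀ : E) :
    ∃ y ∈ closedBall x₀ r, u y = ballMax u x₀ r := by
  rw [ballMax_eq_sSup_image hr]
  exact (isCompact_closedBall x₀ r).image hu |>.sSup_mem ((nonempty_closedBall.2 hr).image u)

theorem le_ballMax (hu : Continuous u) (hz : z ∈ closedBall x₀ r) : u z ≤ ballMax u x₀ r := by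
  rw [ballMax_eq_sSup_image (dist_nonneg.trans hz)]
  exact le_csSup ((isCompact_closedBall x₀ r).image hu).bddAbove (mem_image_of_mem u hz)

theorem exists_ballMax_add_ballMax_le_midpoint (hu : Continuous u) (hw : Continuous w) (x₀ : E)
    {t : ℝ} (ht : t ∈ Icc (-ε) ε) :
    ∃ z ∈ closedBall x₀ ε, ballMax u x₀ (ε + t) + ballMax w x₀ (ε - t) ≤
      ballMax u z ε + ballMax w z ε := by
  obtain ⟨y₁, hy₁, hy₁_eq⟩ :=
    exists_mem_closedBall_eq_ballMax hu (show 0 ≤ ε + t by linarith [ht.1]) x₀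
  obtain ⟨y₂, hy₂, hy₂_eq⟩ :=
    exists_mem_closedBall_eq_ballMax hw (show 0 ≤ ε - t by linarith [ht.2]) x₀
  rw [mem_closedBall] at hy₁ hy₂
  have hdist : dist y₁ y₂ ≤ 2 * ε := by linarith [dist_triangle_right y₁ y₂ x₀]
  refine ⟨midpoint ℝ y₁ y₂, ?_, ?_⟩
  · have := dist_midpoint_midpoint_le y₁ y₂ x₀ x₀
    rw [midpoint_self] at this
    rw [mem_closedBall]
    linarith
  · rw [← hy₁_eq, ← hy₂_eq]
    refine add_le_add (le_ballMax hu ?_) (le_ballMax hw ?_)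
    · rw [mem_closedBall, dist_left_midpoint, Real.norm_ofNat]
      linarith
    · rw [mem_closedBall, dist_right_midpoint, Real.norm_ofNat]
      linarith

end BallMax

section RadialMaxima

variable {n : ℕ} {Ω : Set (EuclideanSpace ℝ (Fin n))} {F G u w : EuclideanSpace ℝ (Fin n) → ℝ}
  {x₀ : EuclideanSpace ℝ (Fin n)} {c d r R ε : ℝ}

theorem mem_sphere_of_isLocalMax_ballMax_sub {E : Type*} [NormedAddCommGroup E] [NormedSpace ℝ E]
    [ProperSpace E] {u : E → ℝ} {x₀ y : E} {q : ℝ → ℝ} (hu : Continuous u)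
    (hq : DifferentiableAt ℝ q r) (hq_pos : 0 < deriv q r)
    (hmax : IsLocalMax (fun s => ballMax u x₀ s - q s) r) (hy : y ∈ closedBall x₀ r)
    (hy_eq : u y = ballMax u x₀ r) : y ∈ sphere x₀ r := by
  refine (mem_closedBall.1 hy).antisymm (le_of_not_gt fun hlt => ?_)
  have hslope : ∀ᶠ s in 𝓝[<] r, 0 < slope q r s :=
    (hq.hasDerivAt.tendsto_slope.eventually (lt_mem_nhds hq_pos)).filter_mono
      (nhdsWithin_mono r fun s hs => ne_of_lt hs)
  obtain ⟨s, ⟨hs_slope, hs_max⟩, hs_dist, hsr⟩ := ((hslope.and (nhdsWithin_le_nhds hmax)).and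
    (Ioo_mem_nhdsLT hlt)).exists
  have hq_lt : q s < q r := (slope_pos_iff_of_le hsr.le).1 (slope_comm q r s ▸ hs_slope)
  have hy_le : u y ≤ ballMax u x₀ s := le_ballMax hu hs_dist.le
  linarith

theorem IsLocalSubsolution.isIncreasingSubsolutionOn_ballMax
    (hu : IsLocalSubsolution (ball x₀ R) F u) (hcont : Continuous u)
    (hc : ∀ x ∈ ball x₀ R, c ≤ F x) :
    IsIncreasingSubsolutionOn c (ballMax u x₀) (Ioo 0 R) := by
  intro t ⟨ht, htR⟩ q hq hq_pos hmax
  obtain ⟨y, hy, hy_eq⟩ := exists_mem_closedBall_eq_ballMax hcont ht.le x₀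
  have hyt : ‖y - x₀‖ = t := mem_sphere_iff_norm.1 <|
    mem_sphere_of_isLocalMax_ballMax_sub hcont (hq.differentiableAt two_ne_zero) hq_pos hmax hy
      hy_eq
  have hy_ball : y ∈ ball x₀ R := mem_ball_iff_norm.2 (hyt.trans_lt htR)
  have hne : y ≠ x₀ := sub_ne_zero.1 (norm_pos_iff.1 (hyt ▸ ht))
  subst hyt
  have htouch : IsLocalMax (fun x => u x - q ‖x - x₀‖) y := by
    have hnorm : ContinuousAt (fun x => ‖x - x₀‖) y := by fun_prop
    filter_upwards [hnorm.eventually hmax] with x hx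
    have : u x ≤ ballMax u x₀ ‖x - x₀‖ := le_ballMax hcont (dist_eq_norm x x₀).le
    linarith
  calc c ≤ F y := hc y hy_ball
    _ ≤ infinityLaplacian (fun x => q ‖x - x₀‖) y :=
      hu y hy_ball _ (contDiffAt_comp_norm_sub hne hq) htouch
    _ = _ := infinityLaplacian_comp_norm_sub hne hq

theorem IsLocalSubsolution.lt_ballMax (hu : IsLocalSubsolution Ω F u) (hcont : Continuous u)
    (hx₀ : x₀ ∈ Ω) (hF : 0 < F x₀) (hr : 0 < r) : u x₀ < ballMax u x₀ r := by
  by_contra! hle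
  have hmax : IsLocalMax (fun y => u y - 0) x₀ := by
    filter_upwards [closedBall_mem_nhds x₀ hr] with y hy
    linarith [le_ballMax hcont hy]
  have := hu x₀ hx₀ _ contDiffAt_const hmax
  rw [infinityLaplacian_const] at this
  exact this.not_gt hF

theorem IsLocalSubsolution.exists_ballMax_add_ballMax_lt
    (hu : IsLocalSubsolution (ball x₀ (2 * ε)) F u) (hw : IsLocalSubsolution (ball x₀ (2 * ε)) G w)
    (hu_cont : Continuous u) (hw_cont : Continuous w) (hε : 0 < ε)
    (hc : ∀ x ∈ ball x₀ (2 * ε), c ≤ F x) (hd : ∀ x ∈ ball x₀ (2 * ε), d ≤ G x)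
    (hc_pos : 0 < c) (hcd : 0 < c + d) :
    ∃ z ∈ closedBall x₀ ε, ballMax u x₀ ε + ballMax w x₀ ε < ballMax u z ε + ballMax w z ε := by
  have hx₀ : x₀ ∈ ball x₀ (2 * ε) := mem_ball_self (by positivity)
  have hcontinuous {f : EuclideanSpace ℝ (Fin n) → ℝ} (hf : Continuous f) :
      Continuous (ballMax f x₀) := continuous_ballMax hf continuous_const continuous_id
  obtain ⟨t, ht, hlt⟩ := IsIncreasingSubsolutionOn.exists_lt_add_reflect (a := ε) (r := ε)
    (by simpa [two_mul] using hu.isIncreasingSubsolutionOn_ballMax hu_cont hc)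
    (by simpa [two_mul] using hw.isIncreasingSubsolutionOn_ballMax hw_cont hd)
    (hcontinuous hu_cont).continuousOn (hcontinuous hw_cont).continuousOn hc_pos hcd hε
    (by simpa using hu.lt_ballMax hu_cont hx₀ (hc_pos.trans_le (hc x₀ hx₀)) hε)
  obtain ⟨z, hz, hle⟩ := exists_ballMax_add_ballMax_le_midpoint hu_cont hw_cont x₀ ht
  exact ⟨z, hz, hlt.trans_le hle⟩

end RadialMaxima

theorem exists_isMaxOn_frequently_exists_isMaxOn {X T : Type*} [TopologicalSpace X]
    [TopologicalSpace T] {K : Set X} (hK : IsCompact K) (hne : K.Nonempty)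
    {Φ : T → X → ℝ} (hΦ : Continuous fun p : T × X => Φ p.1 p.2)
    {l : Filter T} [l.NeBot] {t₀ : T} (hl : l ≤ 𝓝 t₀) :
    ∃ x₀ ∈ K, IsMaxOn (Φ t₀) K x₀ ∧ ∀ U ∈ 𝓝 x₀, ∃ᶠ t in l, ∃ x ∈ U, IsMaxOn (Φ t) K x := by
  have hmax (t : T) : ∃ x ∈ K, IsMaxOn (Φ t) K x :=
    hK.exists_isMaxOn hne (hΦ.comp (.prodMk_right t)).continuousOn
  choose x hxK hx_max using hmax
  obtain ⟨x₀, hx₀, hcluster⟩ := hK.exists_mapClusterPt (f := l) (u := x)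
    (tendsto_principal.2 (.of_forall hxK))
  refine ⟨x₀, hx₀, fun y hy => ?_, fun U hU =>
    (hcluster.frequently hU).mono fun t ht => ⟨x t, ht, hx_max t⟩⟩
  by_contra hlt
  have hnear : ∀ᶠ p in 𝓝 t₀ ×ˢ 𝓝 x₀, Φ p.1 p.2 < Φ p.1 y := by
    rw [← nhds_prod_eq]
    exact hΦ.continuousAt.eventually_lt
      (hΦ.comp (continuous_fst.prodMk continuous_const)).continuousAt (not_le.1 hlt)
  obtain ⟨P, hP, Q, hQ, hPQ⟩ := eventually_prod_iff.1 hnear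
  obtain ⟨t, htQ, htP⟩ := ((hcluster.frequently hQ).and_eventually (hl hP)).exists
  exact (hPQ htP htQ).not_ge (hx_max t hy)

theorem exists_continuous_eqOn.{u, v} {X : Type u} {Y : Type v} [TopologicalSpace X]
    [NormalSpace X] [TopologicalSpace Y] [TietzeExtension.{u, v} Y] {s : Set X} {f : X → Y}
    (hs : IsClosed s) (hf : ContinuousOn f s) : ∃ g : X → Y, Continuous g ∧ EqOn f g s := by
  obtain ⟨g, hg⟩ := ContinuousMap.exists_restrict_eq hs ⟨s.domRestrict f, hf.domRestrict⟩
  exact ⟨g, g.continuous, fun x hx => (DFunLike.congr_fun hg ⟨x, hx⟩).symm⟩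

theorem frontier_inter_preimage_Ioi_zero_subset {X : Type*} [TopologicalSpace X] {Ω : Set X}
    {F : X → ℝ} (hΩ : IsOpen Ω) (hF : ContinuousOn F Ω) (hF₀ : ∀ x ∈ Ω, F x ≠ 0) :
    frontier (Ω ∩ F ⁻¹' Ioi 0) ⊆ frontier Ω := by
  have hpos := hF.isOpen_inter_preimage hΩ (isOpen_Ioi (a := (0 : ℝ)))
  have hneg := hF.isOpen_inter_preimage hΩ (isOpen_Iio (a := (0 : ℝ)))
  have hdisjoint : Disjoint (closure (Ω ∩ F ⁻¹' Ioi 0)) (Ω ∩ F ⁻¹' Iio 0) :=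
    Disjoint.closure_left
      (disjoint_left.2 fun x hx hx' => lt_asymm (show 0 < F x from hx.2) hx'.2) hneg
  rw [hpos.frontier_eq, hΩ.frontier_eq]
  refine fun x hx => ⟨closure_mono inter_subset_left hx.1, fun hxΩ => ?_⟩
  rcases (hF₀ x hxΩ).lt_or_gt with hlt | hgt
  · exact disjoint_left.1 hdisjoint hx.1 ⟨hxΩ, hlt⟩
  · exact hx.2 ⟨hxΩ, hgt⟩

section Comparison

variable {n : ℕ} {Ω : Set (EuclideanSpace ℝ (Fin n))} {F G u w : EuclideanSpace ℝ (Fin n) → ℝ}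

namespace IsLocalSubsolution

theorem add_nonpos_of_continuous (hΩ : IsOpen Ω) (hΩ_bdd : Bornology.IsBounded Ω)
    (hu : IsLocalSubsolution Ω F u) (hw : IsLocalSubsolution Ω G w)
    (hu_cont : Continuous u) (hw_cont : Continuous w)
    (hF : LowerSemicontinuousOn F Ω) (hG : LowerSemicontinuousOn G Ω)
    (hF_pos : ∀ x ∈ Ω, 0 < F x) (hFG : ∀ x ∈ Ω, 0 < F x + G x)
    (hbdry : ∀ x ∈ frontier Ω, u x + w x ≤ 0) : ∀ x ∈ Ω, u x + w x ≤ 0 := by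
  intro p hp
  by_contra! hp_pos
  have hballMax {f : EuclideanSpace ℝ (Fin n) → ℝ} (hf : Continuous f) :
      Continuous fun a : ℝ × EuclideanSpace ℝ (Fin n) => ballMax f a.2 a.1 :=
    continuous_ballMax hf continuous_snd continuous_fst
  obtain ⟨x₀, hx₀, hmax₀, hmax⟩ := exists_isMaxOn_frequently_exists_isMaxOn
    (Φ := fun ε z => ballMax u z ε + ballMax w z ε) hΩ_bdd.isCompact_closure
    ⟨p, subset_closure hp⟩ ((hballMax hu_cont).add (hballMax hw_cont))
    (nhdsWithin_le_nhds (a := (0 : ℝ)) (s := Ioi 0))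
  have hx₀_pos : 0 < u x₀ + w x₀ := hp_pos.trans_le (by simpa using hmax₀ (subset_closure hp))
  have hx₀Ω : x₀ ∈ Ω := by
    by_contra h
    exact hx₀_pos.not_ge (hbdry x₀ (hΩ.frontier_eq ▸ ⟨hx₀, h⟩))
  obtain ⟨c, hc, hcF⟩ : ∃ c, max 0 (-G x₀) < c ∧ c < F x₀ :=
    exists_between (max_lt (hF_pos x₀ hx₀Ω) (by linarith [hFG x₀ hx₀Ω]))
  obtain ⟨hc_pos, hcG⟩ := max_lt_iff.1 hc
  obtain ⟨d, hcd, hdG⟩ : ∃ d, -c < d ∧ d < G x₀ := exists_between (by linarith)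
  obtain ⟨ρ, hρ, hball⟩ := Metric.eventually_nhds_iff_ball.1 <| (hΩ.eventually_mem hx₀Ω).and <|
    (hΩ.nhdsWithin_eq hx₀Ω ▸ hF x₀ hx₀Ω c hcF).and (hΩ.nhdsWithin_eq hx₀Ω ▸ hG x₀ hx₀Ω d hdG)
  obtain ⟨ε, ⟨x, hx, hx_max⟩, hε, hε_lt⟩ := ((hmax _ (ball_mem_nhds x₀ (half_pos hρ))
    ).and_eventually (Ioo_mem_nhdsGT (show (0 : ℝ) < ρ / 4 by positivity))).exists
  have hsub : ball x (2 * ε) ⊆ ball x₀ ρ := by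
    refine ball_subset_ball' ?_
    linarith [mem_ball.1 hx]
  obtain ⟨z, hz, hlt⟩ := (hu.mono fun y hy => (hball y (hsub hy)).1).exists_ballMax_add_ballMax_lt
    (hw.mono fun y hy => (hball y (hsub hy)).1) hu_cont hw_cont hε
    (fun y hy => (hball y (hsub hy)).2.1.le) (fun y hy => (hball y (hsub hy)).2.2.le) hc_pos
    (by linarith)
  have hzΩ : z ∈ Ω := (hball z (hsub (closedBall_subset_ball (by linarith) hz))).1
  exact hlt.not_ge (hx_max (subset_closure hzΩ))

theorem add_nonpos (hΩ : IsOpen Ω) (hΩ_bdd : Bornology.IsBounded Ω)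
    (hu : IsLocalSubsolution Ω F u) (hw : IsLocalSubsolution Ω G w)
    (hu_cont : ContinuousOn u (closure Ω)) (hw_cont : ContinuousOn w (closure Ω))
    (hF : LowerSemicontinuousOn F Ω) (hG : LowerSemicontinuousOn G Ω)
    (hF_pos : ∀ x ∈ Ω, 0 < F x) (hFG : ∀ x ∈ Ω, 0 < F x + G x)
    (hbdry : ∀ x ∈ frontier Ω, u x + w x ≤ 0) : ∀ x ∈ Ω, u x + w x ≤ 0 := by
  obtain ⟨u', hu'_cont, huu'⟩ := exists_continuous_eqOn isClosed_closure hu_cont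
  obtain ⟨w', hw'_cont, hww'⟩ := exists_continuous_eqOn isClosed_closure hw_cont
  have hadd (x) (hx : x ∈ closure Ω) : u x + w x = u' x + w' x := by rw [huu' hx, hww' hx]
  intro x hx
  rw [hadd x (subset_closure hx)]
  exact add_nonpos_of_continuous hΩ hΩ_bdd (hu.congr hΩ (huu'.mono subset_closure))
    (hw.congr hΩ (hww'.mono subset_closure)) hu'_cont hw'_cont hF hG hF_pos hFG
    (fun y hy => hadd y hy.1 ▸ hbdry y hy) x hx

theorem add_nonpos_of_neg (hΩ : IsOpen Ω) (hΩ_bdd : Bornology.IsBounded Ω)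
    (hu : IsLocalSubsolution Ω F u) (hw : IsLocalSubsolution Ω (fun x => -F x) w)
    (hu_cont : ContinuousOn u (closure Ω)) (hw_cont : ContinuousOn w (closure Ω))
    (hF : ContinuousOn F Ω) (hF_pos : ∀ x ∈ Ω, 0 < F x)
    (hbdry : ∀ x ∈ frontier Ω, u x + w x ≤ 0) : ∀ x ∈ Ω, u x + w x ≤ 0 := by
  obtain ⟨B, hB⟩ := (hΩ_bdd.isCompact_closure.image_of_continuousOn hu_cont).bddAbove
  intro x hx
  -- Scaling `u` by `1 + δ` makes the inequality strict; subtracting `δ * B` restores the boundary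
  -- condition.
  have hscaled (δ : ℝ) (hδ : 0 < δ) : (1 + δ) * u x + -(δ * B) + w x ≤ 0 := by
    have hcube : 1 < (1 + δ) ^ 3 := one_lt_pow₀ (by linarith) (by norm_num)
    refine add_nonpos hΩ hΩ_bdd (hu.const_mul_add (by positivity) _) hw
      ((continuousOn_const.mul hu_cont).add continuousOn_const) hw_cont
      (continuousOn_const.mul hF).lowerSemicontinuousOn hF.neg.lowerSemicontinuousOn
      (fun y hy => mul_pos (by positivity) (hF_pos y hy)) (fun y hy => ?_) (fun y hy => ?_) x hx
    · linarith [lt_mul_of_one_lt_left (hF_pos y hy) hcube]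
    · have := mul_le_mul_of_nonneg_left (hB (mem_image_of_mem u hy.1)) hδ.le
      linarith [hbdry y hy]
  have hlim : Tendsto (fun δ : ℝ => (1 + δ) * u x + -(δ * B) + w x) (𝓝[>] 0) (𝓝 (u x + w x)) :=
    tendsto_nhdsWithin_of_tendsto_nhds (Continuous.tendsto' (by fun_prop) _ _ (by simp))
  exact le_of_tendsto hlim (eventually_mem_nhdsWithin.mono hscaled)

theorem add_nonpos_of_pos_of_ne_zero (hΩ : IsOpen Ω) (hΩ_bdd : Bornology.IsBounded Ω)
    (hu : IsLocalSubsolution Ω F u) (hw : IsLocalSubsolution Ω (fun x => -F x) w)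
    (hu_cont : ContinuousOn u (closure Ω)) (hw_cont : ContinuousOn w (closure Ω))
    (hF : ContinuousOn F Ω) (hF₀ : ∀ x ∈ Ω, F x ≠ 0)
    (hbdry : ∀ x ∈ frontier Ω, u x + w x ≤ 0) : ∀ x ∈ Ω, 0 < F x → u x + w x ≤ 0 := by
  have hsub : Ω ∩ F ⁻¹' Ioi 0 ⊆ Ω := inter_subset_left
  have hfrontier := frontier_inter_preimage_Ioi_zero_subset hΩ hF hF₀
  exact fun x hx hFx => add_nonpos_of_neg (hF.isOpen_inter_preimage hΩ isOpen_Ioi)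
    (hΩ_bdd.subset hsub) (hu.mono hsub) (hw.mono hsub) (hu_cont.mono (closure_mono hsub))
    (hw_cont.mono (closure_mono hsub)) (hF.mono hsub) (fun y hy => hy.2)
    (fun y hy => hbdry y (hfrontier hy)) x ⟨hx, hFx⟩

end IsLocalSubsolution

end Comparison

theorem ne_zero_of_sInf_image_pos_or_sSup_image_neg {X : Type*} {f : X → ℝ} {s : Set X}
    (h : 0 < sInf (f '' s) ∨ sSup (f '' s) < 0) {x : X} (hx : x ∈ s) : f x ≠ 0 := by
  intro hzero
  have hmem : ∃ y ∈ f '' s, y = 0 := ⟨_, mem_image_of_mem f hx, hzero⟩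
  rcases h with h | h
  · exact h.not_ge (Real.sInf_nonpos' (hmem.imp fun y hy => ⟨hy.1, hy.2.le⟩))
  · exact h.not_ge (Real.sSup_nonneg' (hmem.imp fun y hy => ⟨hy.1, hy.2.ge⟩))

theorem mainTheorem11_general {n : ℕ} {Ω : Set (EuclideanSpace ℝ (Fin n))} (hΩ : IsOpen Ω)
    (hΩ_bdd : Bornology.IsBounded Ω) {u v F : EuclideanSpace ℝ (Fin n) → ℝ}
    (hu : ContinuousOn u (closure Ω)) (hv : ContinuousOn v (closure Ω))
    (hF : ContinuousOn F Ω) (hF₀ : ∀ x ∈ Ω, F x ≠ 0)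
    (hv_super : IsViscositySupersolution Ω F v) (hu_sub : IsViscositySubsolution Ω F u)
    (hbdry : ∀ x ∈ frontier Ω, u x ≤ v x) : ∀ x ∈ Ω, u x ≤ v x := by
  have hbddAbove {f : EuclideanSpace ℝ (Fin n) → ℝ} (hf : ContinuousOn f (closure Ω)) :
      BddAbove (f '' Ω) :=
    (hΩ_bdd.isCompact_closure.image_of_continuousOn hf).bddAbove.mono (image_mono subset_closure)
  have hu_local := hu_sub.isLocalSubsolution (hbddAbove hu)
  have hv_local := hv_super.neg.isLocalSubsolution (hbddAbove hv.neg)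
  intro x hx
  rcases (hF₀ x hx).lt_or_gt with hneg | hpos
  · have := hv_local.add_nonpos_of_pos_of_ne_zero hΩ hΩ_bdd (by simpa using hu_local) hv.neg hu
      hF.neg (fun y hy => neg_ne_zero.2 (hF₀ y hy)) (fun y hy => by linarith [hbdry y hy]) x hx
      (neg_pos.2 hneg)
    linarith
  · have := hu_local.add_nonpos_of_pos_of_ne_zero hΩ hΩ_bdd hv_local hu hv.neg hF hF₀
      (fun y hy => by linarith [hbdry y hy]) x hx hpos
    linarith

theorem mainTheorem11 (n : ℕ) (Ω : Set (EuclideanSpace ℝ (Fin n)))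
    (hΩ_open : IsOpen Ω) (hΩ_conn : IsConnected Ω) (hΩ_bdd : Bornology.IsBounded Ω)
    (u v F : EuclideanSpace ℝ (Fin n) → ℝ)
    (hu : ContinuousOn u (closure Ω)) (hv : ContinuousOn v (closure Ω))
    (hF : ContinuousOn F Ω)
    (hFsign : 0 < sInf (F '' Ω) ∨ sSup (F '' Ω) < 0)
    (hv_super : IsViscositySupersolution Ω F v)
    (hu_sub : IsViscositySubsolution Ω F u)
    (h_bdry : ∀ x ∈ frontier Ω, u x ≤ v x) :
    ∀ x ∈ Ω, u x ≤ v x :=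
  mainTheorem11_general hΩ_open hΩ_bdd hu hv hF
    (fun _ hx => ne_zero_of_sInf_image_pos_or_sSup_image_neg hFsign hx) hv_super hu_sub h_bdry
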